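/- **Theorem.** A binary tree is either a single leaf, or an inner node together with an ordered pair of binary trees (its left and right subtree); its size is its number of inner nodes. The register function (Horton–Strahler number) of a binary tree is defined by $\operatorname{Reg}(t)=0$ if $t$ is a single leaf and, if $t$ has subtrees $t_1,t_2$, by $\operatorname{Reg}(t)=\max\{\operatorname{Reg}(t_1),\operatorname{Reg}(t_2)\}$ if $\operatorname{Reg}(t_1)\neq\operatorname{Reg}(t_2)$ and $\operatorname{Reg}(t)=\operatorname{Reg}(t_1)+1$ otherwise. Label each node of a binary tree (inner nodes as well as leaves) with the value of the register function of the subtree rooted at it. For $r\ge 0$, an $r$-branch of the tree is a maximal connected set of nodes labeled $r$ (which is necessarily a chain). Let $X_{n;r}$ be the number of $r$-branches in a binary tree chosen uniformly at random among all binary trees of size $n$. Let $r\in\mathbb{N}_0$ be fixed. Then, as $n\to\infty$, \begin{align*} \mathbb{E} X_{n;r} &= \frac{n}{4^{r}} + \frac{1}{6}\Big(1+\frac{5}{4^{r}}\Big) + \frac{1}{20n}\Big(4^{r}-\frac{1}{4^{r}}\Big) + \frac{1}{12n^{2}}\Big(\frac{5\cdot 16^{r}}{21}-\frac{7\cdot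 4^{r}}{10}+\frac{97}{210\cdot 4^{r}}\Big) + O(n^{-3}),\\ \mathbb{V} X_{n;r} &= \frac{4^{r}-1}{3\cdot 16^{r}}\,n - \frac{2\cdot 16^{r}-25\cdot 4^{r}+23}{90\cdot 16^{r}} - \frac{13\cdot 64^{r}-14\cdot 16^{r}+7\cdot 4^{r}-6}{420\cdot 16^{r}\,n} + O(n^{-2}), \end{align*} where the constants implied by the $O$-terms may depend on $r$. -/

import Mathlib

namespace RBranches

/-!
A binary tree is a term of `BinaryTree Unit`: `BinaryTree.nil` is the tree consisting of a single leaf, and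
`BinaryTree.node () t₁ t₂` is an inner node with left subtree `t₁` and right subtree `t₂`. The size of a
tree is its number of inner nodes, `BinaryTree.numNodes`. The leaves (every occurrence of `BinaryTree.nil`)
are nodes of the tree as well.
-/

/-- The register function (Horton–Strahler number) of a binary tree. -/
def reg : BinaryTree Unit → ℕ
  | BinaryTree.nil => 0
  | BinaryTree.node _ t₁ t₂ => if reg t₁ = reg t₂ then reg t₁ + 1 else max (reg t₁) (reg t₂)

/-- The subtree of `t` rooted at the node with address `p`, if there is such a node. The address
of a node (inner node or leaf) is the sequence of turns on the way from the root to it,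
`false` for left and `true` for right. -/
def subtreeAt : BinaryTree Unit → List Bool → Option (BinaryTree Unit)
  | t, [] => some t
  | BinaryTree.nil, _ :: _ => none
  | BinaryTree.node _ t₁ _, false :: p => subtreeAt t₁ p
  | BinaryTree.node _ _ t₂, true :: p => subtreeAt t₂ p

/-- The nodes (inner nodes and leaves) of `t` labeled `r`; the label of a node is the value of the
register function of the subtree rooted at it. -/
def nodesLabeled (t : BinaryTree Unit) (r : ℕ) : Set (List Bool) :=
  {p | ∃ s, subtreeAt t p = some s ∧ reg s = r}

/-- The parent–child adjacency of addresses; restricted to the nodes of a binary tree, this is the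
tree as a graph. -/
def addressGraph : SimpleGraph (List Bool) :=
  SimpleGraph.fromRel fun p q => ∃ b, q = p ++ [b]

/-- The `r`-branches of `t`: the maximal connected sets (chains) of nodes labeled `r`, i.e. the
connected components of the subgraph of `t` induced by the nodes labeled `r`. -/
abbrev Branch (t : BinaryTree Unit) (r : ℕ) : Type :=
  (addressGraph.induce (nodesLabeled t r)).ConnectedComponent

/-- The number of `r`-branches of `t`. -/
noncomputable def numBranches (r : ℕ) (t : BinaryTree Unit) : ℕ := Nat.card (Branch t r)

/-- The expected value of `X t` for `t` uniformly random among the binary trees of size `n`. -/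
noncomputable def expectation (n : ℕ) (X : BinaryTree Unit → ℝ) : ℝ :=
  (∑ t ∈ BinaryTree.treesOfNumNodesEq n, X t) / ((BinaryTree.treesOfNumNodesEq n).card : ℝ)

/-- The variance of `X t` for `t` uniformly random among the binary trees of size `n`. -/
noncomputable def variance (n : ℕ) (X : BinaryTree Unit → ℝ) : ℝ :=
  expectation n fun t => (X t - expectation n X) ^ 2

end RBranches

open scoped Asymptotics

/-! Each branch has exactly one node nearest the root, so branches can be counted by these top
nodes. This count is additive over the two subtrees, plus one exactly when both subtrees have
register `r - 1`.

Additivity turns into equations for generating functions. Write `ε = 1 - 4 X` and `V_r =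
reducedSeries r`. The total number of branches has series `V_r / (X √ε)`, and the second factorial
moment has series `2 V_r ^ 2 / (X ε ^ (3/2))`. The recursion for trees by register gives `V_{r+1} (ε
+ 4 V_r) = V_r ^ 2` (`lowRegSeries_sq`, `reducedSeries_succ_mul`), and this determines the expansion
of `V_r` in powers of `ε`. The coefficients up to `ε ^ 3` are rational in `4 ^ r` and are checked by
induction (`reducedSeries_expansion`).

Singularity analysis is done without complex function theory. All remainders lie in an algebra of
power series that are absolutely summable with a weight slightly above `4 ^ (-n)`. Dividing by `ε +
4 V_r = S_r ^ 2`, where `S_r = lowRegSeries r`, stays in this algebra because `S_r` is invertible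
there (`regSeries_lowRegSeries_mem`). Multiplying by an element of the algebra preserves the
coefficient order of a half-integral power of `ε` (`exists_abs_coeff_mul_le`), so the term `ε ^ 4 H`
affects only the error. The other coefficients are explicit multiples of central binomial
coefficients, and division by the Catalan number leaves rational functions of `n`. -/

namespace RBranches

open BinaryTree

/-! ### Counting branches by their top nodes -/

/-- The elements of a set of addresses whose parent is not in the set. -/
def topNodes (S : Set (List Bool)) : Set (List Bool) :=
  {p | p ∈ S ∧ ∀ q b, p = q ++ [b] → q ∉ S}

theorem addressGraph_adj {p q : List Bool} :
    addressGraph.Adj p q ↔ (∃ b, q = p ++ [b]) ∨ ∃ b, p = q ++ [b] := by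
  rw [addressGraph, SimpleGraph.fromRel_adj]
  refine ⟨fun h => h.2, fun h => ⟨?_, h⟩⟩
  rintro rfl
  rcases h with ⟨b, hb⟩ | ⟨b, hb⟩ <;> simpa using congrArg List.length hb

/-- An invariant of walks in `S`, used from a top node `p`: one stays below `p`, with the whole path
from `p` inside `S`. A step to a child extends the path; a step to a parent could leave the region
only through the parent of `p`, which is not in `S`. -/
theorem prefix_of_reachable {S : Set (List Bool)} {p : List Bool} (hp : p ∈ topNodes S)
    {x y : S} (h : (addressGraph.induce S).Reachable x y)
    (hx : p <+: x.1 ∧ ∀ z, p <+: z → z <+: x.1 → z ∈ S) :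
    p <+: y.1 ∧ ∀ z, p <+: z → z <+: y.1 → z ∈ S := by
  obtain ⟨w⟩ := h
  induction w with
  | nil => exact hx
  | @cons u v w' hadj _ ih =>
    apply ih
    rw [SimpleGraph.comap_adj, Function.Embedding.subtype_apply, Function.Embedding.subtype_apply,
      addressGraph_adj] at hadj
    rcases hadj with ⟨b, hb⟩ | ⟨b, hb⟩
    · rw [hb]
      refine ⟨hx.1.trans (List.prefix_append _ _), fun z hz hz' => ?_⟩
      rcases List.prefix_concat_iff.1 hz' with h | h
      · rw [h, ← hb]; exact v.2
      · exact hx.2 z hz h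
    · have h1 := hx.1
      rw [hb] at h1
      rcases List.prefix_concat_iff.1 h1 with h | h
      · exact absurd v.2 (hp.2 _ _ h)
      · exact ⟨h, fun z hz hz' => hx.2 z hz (hz'.trans (hb ▸ List.prefix_append _ _))⟩

theorem exists_topNode_reachable {S : Set (List Bool)} (x : S) :
    ∃ y : S, y.1 ∈ topNodes S ∧ (addressGraph.induce S).Reachable y x := by
  obtain ⟨p, hp⟩ := x
  induction p using List.reverseRecOn with
  | nil => exact ⟨⟨[], hp⟩, ⟨hp, fun q b h => by simp at h⟩, SimpleGraph.Reachable.refl _⟩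
  | append_singleton q b ih =>
    by_cases hq : q ∈ S
    · obtain ⟨y, hy, hr⟩ := ih hq
      refine ⟨y, hy, hr.trans (SimpleGraph.Adj.reachable ?_)⟩
      rw [SimpleGraph.comap_adj]
      exact addressGraph_adj.2 (Or.inl ⟨b, rfl⟩)
    · refine ⟨⟨q ++ [b], hp⟩, ⟨hp, fun q' b' h => ?_⟩, SimpleGraph.Reachable.refl _⟩
      obtain ⟨rfl, -⟩ := List.append_inj' h rfl
      exact hq

theorem card_connectedComponent_induce (S : Set (List Bool)) :
    Nat.card (addressGraph.induce S).ConnectedComponent = (topNodes S).ncard := by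
  rw [← Nat.card_coe_set_eq]
  symm
  refine Nat.card_congr (Equiv.ofBijective
    (fun p : topNodes S => (addressGraph.induce S).connectedComponentMk ⟨p.1, p.2.1⟩) ⟨?_, ?_⟩)
  · rintro ⟨p, hp⟩ ⟨q, hq⟩ h
    have h := SimpleGraph.ConnectedComponent.exact h
    have key := prefix_of_reachable hp h ⟨List.prefix_rfl, fun z h1 h2 => by
      obtain rfl := h2.eq_of_length (le_antisymm h2.length_le h1.length_le)
      exact hp.1⟩
    dsimp only at key
    obtain ⟨⟨l, rfl⟩, h2⟩ := key
    rcases List.eq_nil_or_concat l with rfl | ⟨l', b, rfl⟩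
    · simp
    -- If the top node `q` lay strictly below `p`, its parent `p ++ l'` would be on the path from
    -- `p` and hence in `S`.
    · refine absurd (h2 (p ++ l') (List.prefix_append _ _) ?_) (hq.2 (p ++ l') b ?_)
      · rw [List.concat_eq_append, ← List.append_assoc]; exact List.prefix_append _ _
      · simp
  · intro c
    induction c using SimpleGraph.ConnectedComponent.ind with
    | h x =>
      obtain ⟨y, hy, hr⟩ := exists_topNode_reachable x
      exact ⟨⟨y.1, hy⟩, SimpleGraph.ConnectedComponent.sound hr⟩

theorem nil_mem_nodesLabeled {t : BinaryTree Unit} {r : ℕ} :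
    [] ∈ nodesLabeled t r ↔ reg t = r := by
  cases t <;> simp [nodesLabeled, subtreeAt]

theorem nil_mem_topNodes {t : BinaryTree Unit} {r : ℕ} :
    [] ∈ topNodes (nodesLabeled t r) ↔ reg t = r := by
  simp [topNodes, nil_mem_nodesLabeled]

theorem cons_notMem_nodesLabeled_nil (x : Bool) (p : List Bool) (r : ℕ) :
    x :: p ∉ nodesLabeled nil r := by
  simp [nodesLabeled, subtreeAt]

theorem cons_mem_nodesLabeled_node (x : Bool) (p : List Bool) (a b : BinaryTree Unit) (r : ℕ) :
    x :: p ∈ nodesLabeled (node () a b) r ↔ p ∈ nodesLabeled (cond x b a) r := by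
  cases x <;> simp [nodesLabeled, subtreeAt]

theorem cons_mem_topNodes_node (x : Bool) (p : List Bool) (a b : BinaryTree Unit) (r : ℕ) :
    x :: p ∈ topNodes (nodesLabeled (node () a b) r) ↔
      p ∈ topNodes (nodesLabeled (cond x b a) r) ∧ (p = [] → reg (node () a b) ≠ r) := by
  simp only [topNodes, Set.mem_ofPred_eq, cons_mem_nodesLabeled_node]
  constructor
  · rintro ⟨h1, h2⟩
    refine ⟨⟨h1, fun q y h => ?_⟩, fun h => ?_⟩
    · have := h2 (x :: q) y (by simp [h])
      rwa [cons_mem_nodesLabeled_node] at this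
    · have := h2 [] x (by simp [h])
      rwa [nil_mem_nodesLabeled] at this
  · rintro ⟨⟨h1, h2⟩, h3⟩
    refine ⟨h1, fun q y h => ?_⟩
    cases q with
    | nil =>
      simp only [List.nil_append, List.cons.injEq] at h
      rw [nil_mem_nodesLabeled]
      exact h3 h.2
    | cons z q =>
      simp only [List.cons_append, List.cons.injEq] at h
      rw [← h.1, cons_mem_nodesLabeled_node]
      exact h2 q y h.2

theorem topNodes_node (a b : BinaryTree Unit) (r : ℕ) :
    topNodes (nodesLabeled (node () a b) r) =
      if reg (node () a b) = r then
        insert [] (List.cons false '' (topNodes (nodesLabeled a r) \ {[]}) ∪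
          List.cons true '' (topNodes (nodesLabeled b r) \ {[]}))
      else List.cons false '' topNodes (nodesLabeled a r) ∪
          List.cons true '' topNodes (nodesLabeled b r) := by
  ext p
  rcases p with _ | ⟨x, p⟩
  · rw [nil_mem_topNodes]
    split_ifs with h <;> simp [h]
  · rw [cons_mem_topNodes_node]
    cases x <;> split_ifs with h <;> simp [h]

theorem topNodes_nil (r : ℕ) :
    topNodes (nodesLabeled nil r) = if r = 0 then {[]} else ∅ := by
  ext p
  rcases p with _ | ⟨x, p⟩
  · rw [nil_mem_topNodes]
    split_ifs with h <;> simp [reg, h, eq_comm]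
  · have h1 : x :: p ∉ topNodes (nodesLabeled nil r) :=
      fun h => cons_notMem_nodesLabeled_nil x p r h.1
    split_ifs with h <;> simp [h1]

theorem finite_topNodes (t : BinaryTree Unit) (r : ℕ) : (topNodes (nodesLabeled t r)).Finite := by
  induction t using BinaryTree.unitRecOn with
  | base => rw [topNodes_nil]; split_ifs <;> simp
  | ind a b iha ihb =>
    rw [topNodes_node]
    split_ifs
    · exact (((iha.sdiff).image _).union ((ihb.sdiff).image _)).insert _
    · exact (iha.image _).union (ihb.image _)

theorem numBranches_eq (r : ℕ) (t : BinaryTree Unit) :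
    numBranches r t = (topNodes (nodesLabeled t r)).ncard :=
  card_connectedComponent_induce _

theorem numBranches_nil (r : ℕ) : numBranches r nil = if r = 0 then 1 else 0 := by
  rw [numBranches_eq, topNodes_nil]
  split_ifs <;> simp

theorem ncard_cons_union {A B : Set (List Bool)} (hA : A.Finite) (hB : B.Finite) :
    (List.cons false '' A ∪ List.cons true '' B).ncard = A.ncard + B.ncard := by
  rw [Set.ncard_union_eq _ (hA.image _) (hB.image _),
    Set.ncard_image_of_injective _ List.cons_injective,
    Set.ncard_image_of_injective _ List.cons_injective]
  rw [Set.disjoint_left]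
  rintro _ ⟨p, _, rfl⟩ ⟨q, _, h⟩
  simp at h

theorem ncard_topNodes_diff (t : BinaryTree Unit) (r : ℕ) :
    (topNodes (nodesLabeled t r) \ {[]}).ncard + (if reg t = r then 1 else 0) =
      numBranches r t := by
  rw [numBranches_eq]
  split_ifs with h
  · exact Set.ncard_sdiff_singleton_add_one (nil_mem_topNodes.2 h) (finite_topNodes t r)
  · rw [Set.sdiff_singleton_eq_self (fun h' => h (nil_mem_topNodes.1 h')), add_zero]

/-- If the root is labeled `r`, it absorbs the branch of a child labeled `r`. At most one child has
that label, since two would give the root label `r + 1`. If no child has it, both are labeled `r -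
1` and the root starts a new branch. -/
theorem numBranches_node (r : ℕ) (a b : BinaryTree Unit) :
    numBranches r (node () a b) = numBranches r a + numBranches r b +
      if reg a = reg b ∧ reg a + 1 = r then 1 else 0 := by
  rw [numBranches_eq, topNodes_node]
  split_ifs with h h' h'
  · rw [Set.ncard_insert_of_notMem (by simp)
      (((finite_topNodes a r).sdiff.image _).union ((finite_topNodes b r).sdiff.image _)),
      ncard_cons_union (finite_topNodes a r).sdiff (finite_topNodes b r).sdiff,
      ← ncard_topNodes_diff a, ← ncard_topNodes_diff b, if_neg (by omega), if_neg (by omega), add_zero, add_zero]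
  · rw [Set.ncard_insert_of_notMem (by simp)
      (((finite_topNodes a r).sdiff.image _).union ((finite_topNodes b r).sdiff.image _)),
      ncard_cons_union (finite_topNodes a r).sdiff (finite_topNodes b r).sdiff,
      -- Exactly one child is labeled `r` here: the inserted root compensates for the one deleted
      -- top node.
      ← ncard_topNodes_diff a, ← ncard_topNodes_diff b]
    rw [reg] at h
    split_ifs at h ⊢ <;> omega
  · rw [reg] at h
    split_ifs at h <;> omega
  · rw [ncard_cons_union (finite_topNodes a r) (finite_topNodes b r), numBranches_eq,
      numBranches_eq, add_zero]

theorem numBranches_eq_zero {r : ℕ} {t : BinaryTree Unit} (h : reg t < r) :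
    numBranches r t = 0 := by
  induction t using BinaryTree.unitRecOn with
  | base => rw [numBranches_nil, if_neg (by omega)]
  | ind a b iha ihb =>
    rw [reg] at h
    rw [numBranches_node]
    split_ifs at h ⊢ <;> omega

open PowerSeries Finset

/-! ### Generating functions of tree statistics -/

/-- The generating function of a tree statistic, by the number of inner nodes. -/
noncomputable def treeSeries (f : BinaryTree Unit → ℝ) : PowerSeries ℝ :=
  PowerSeries.mk fun n => ∑ t ∈ treesOfNumNodesEq n, f t

/-- The generating function of a statistic of ordered pairs of trees. -/
noncomputable def pairSeries (f : BinaryTree Unit → BinaryTree Unit → ℝ) : PowerSeries ℝ :=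
  PowerSeries.mk fun n => ∑ ij ∈ antidiagonal n,
    ∑ a ∈ treesOfNumNodesEq ij.1, ∑ b ∈ treesOfNumNodesEq ij.2, f a b

theorem sum_treesOfNumNodesEq_succ (f : BinaryTree Unit → ℝ) (n : ℕ) :
    ∑ t ∈ treesOfNumNodesEq (n + 1), f t = ∑ ij ∈ antidiagonal n,
      ∑ a ∈ treesOfNumNodesEq ij.1, ∑ b ∈ treesOfNumNodesEq ij.2, f (node () a b) := by
  rw [treesOfNumNodesEq_succ, sum_biUnion]
  · refine sum_congr rfl fun ij _ => ?_
    rw [sum_map, sum_product]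
    rfl
  · simp_rw [Set.PairwiseDisjoint, Set.Pairwise, disjoint_left]
    aesop

theorem treeSeries_eq (f : BinaryTree Unit → ℝ) :
    treeSeries f = C (f nil) + X * pairSeries fun a b => f (node () a b) := by
  ext n
  cases n with
  | zero => simp [treeSeries]
  | succ n =>
    rw [map_add, coeff_succ_X_mul, coeff_C, if_neg (Nat.succ_ne_zero n), zero_add, treeSeries,
      pairSeries, coeff_mk, coeff_mk, sum_treesOfNumNodesEq_succ]

theorem pairSeries_mul (f g : BinaryTree Unit → ℝ) :
    pairSeries (fun a b => f a * g b) = treeSeries f * treeSeries g := by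
  ext n
  rw [coeff_mul, pairSeries, coeff_mk]
  refine sum_congr rfl fun ij _ => ?_
  rw [treeSeries, treeSeries, coeff_mk, coeff_mk, sum_mul_sum]

theorem pairSeries_add (f g : BinaryTree Unit → BinaryTree Unit → ℝ) :
    pairSeries (fun a b => f a b + g a b) = pairSeries f + pairSeries g := by
  ext n
  simp [pairSeries, sum_add_distrib]

theorem treeSeries_sum {ι : Type*} (s : Finset ι) (f : ι → BinaryTree Unit → ℝ) :
    treeSeries (fun t => ∑ i ∈ s, f i t) = ∑ i ∈ s, treeSeries (f i) := by
  ext n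
  simp only [treeSeries, coeff_mk, map_sum]
  exact sum_comm

theorem treeSeries_smul (c : ℝ) (f : BinaryTree Unit → ℝ) :
    treeSeries (fun t => c * f t) = C c * treeSeries f := by
  ext n
  simp [treeSeries, mul_sum]

/-- The indicator of the trees with register function `k`. -/
def regIndicator (k : ℕ) (t : BinaryTree Unit) : ℝ := if reg t = k then 1 else 0

/-- The generating function of all binary trees. -/
noncomputable def catalanSeries : PowerSeries ℝ := treeSeries fun _ => 1

/-- `X` times the generating function of the binary trees with register function `k`. -/
noncomputable def regSeries (k : ℕ) : PowerSeries ℝ := X * treeSeries (regIndicator k)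

/-- The series `1 - 2 X S`, where `S` is the generating function of the binary trees with register
function less than `k`. -/
noncomputable def lowRegSeries (k : ℕ) : PowerSeries ℝ := 1 - 2 * ∑ j ∈ range k, regSeries j

/-- The total number of `r`-branches. -/
noncomputable def branchSeries (r : ℕ) : PowerSeries ℝ := treeSeries fun t => numBranches r t

/-- The total number of ordered pairs of distinct `r`-branches. -/
noncomputable def branchPairSeries (r : ℕ) : PowerSeries ℝ :=
  treeSeries fun t => numBranches r t * (numBranches r t - 1)

theorem catalanSeries_eq : catalanSeries = 1 + X * catalanSeries ^ 2 := by
  have h := treeSeries_eq fun _ => 1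
  have h2 := pairSeries_mul (fun _ => 1) (fun _ => 1)
  simp only [mul_one] at h2
  rw [h2, map_one] at h
  rw [catalanSeries, sq]
  exact h

/-- The square root of `1 - 4 X`. -/
noncomputable def sqrtSeries : PowerSeries ℝ := 1 - 2 * X * catalanSeries

theorem sqrtSeries_sq : sqrtSeries ^ 2 = 1 - 4 * X := by
  rw [sqrtSeries]
  linear_combination (-4 * X) * catalanSeries_eq

theorem regSeries_zero : regSeries 0 = X := by
  have h := treeSeries_eq (regIndicator 0)
  have h0 : (fun a b => regIndicator 0 (node () a b)) = fun _ _ => 0 := by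
    ext a b
    rw [regIndicator, reg, if_neg]
    intro h
    split_ifs at h <;> omega
  have h1 : pairSeries (fun _ _ => 0) = 0 := by ext n; simp [pairSeries]
  rw [h0, h1] at h
  simp [regSeries, h, regIndicator, reg]

/-- Register `k + 1` arises from two subtrees of register `k`, or from one of register `k + 1`
beside one of smaller register. -/
theorem regIndicator_succ_node (k : ℕ) (a b : BinaryTree Unit) :
    regIndicator (k + 1) (node () a b) = regIndicator k a * regIndicator k b +
      (regIndicator (k + 1) a * ∑ j ∈ range (k + 1), regIndicator j b +
        (∑ j ∈ range (k + 1), regIndicator j a) * regIndicator (k + 1) b) := by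
  simp only [regIndicator, sum_ite_eq, mem_range, reg]
  split_ifs <;> first | omega | simp

theorem regSeries_succ_mul (k : ℕ) :
    regSeries (k + 1) * lowRegSeries (k + 1) = regSeries k ^ 2 := by
  have h := treeSeries_eq (regIndicator (k + 1))
  simp only [regIndicator_succ_node] at h
  rw [pairSeries_add, pairSeries_add, pairSeries_mul, pairSeries_mul, pairSeries_mul,
    treeSeries_sum] at h
  have h0 : regIndicator (k + 1) nil = 0 := by simp [regIndicator, reg]
  rw [h0, map_zero, zero_add] at h
  simp only [lowRegSeries, regSeries, ← mul_sum]
  linear_combination X * h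

theorem lowRegSeries_succ (k : ℕ) :
    lowRegSeries (k + 1) = lowRegSeries k - 2 * regSeries k := by
  rw [lowRegSeries, lowRegSeries, sum_range_succ]
  ring

/-- The generating function of the `r`-branches, up to the factor `X * sqrt (1 - 4 X)`. -/
noncomputable def reducedSeries : ℕ → PowerSeries ℝ
  | 0 => X
  | r + 1 => regSeries r ^ 2

theorem reducedSeries_eq_mul (k : ℕ) : reducedSeries k = lowRegSeries k * regSeries k := by
  cases k with
  | zero => simp [reducedSeries, lowRegSeries, regSeries_zero]
  | succ k => rw [reducedSeries, ← regSeries_succ_mul, mul_comm]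

/-- Since `S_{k+1} = S_k - 2 B_k` with `B_k = regSeries k`, squaring subtracts `4 S_k B_k = 4 V_k`
and adds `4 B_k ^ 2 = 4 V_{k+1}`, so `S_k ^ 2 - 4 V_k` does not depend on `k`. -/
theorem lowRegSeries_sq (k : ℕ) : lowRegSeries k ^ 2 = (1 - 4 * X) + 4 * reducedSeries k := by
  induction k with
  | zero => simp [lowRegSeries, reducedSeries]
  | succ k ih =>
    rw [lowRegSeries_succ, reducedSeries]
    linear_combination ih + 4 * reducedSeries_eq_mul k

theorem reducedSeries_succ_mul (k : ℕ) :
    reducedSeries (k + 1) * lowRegSeries k ^ 2 = reducedSeries k ^ 2 := by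
  rw [reducedSeries_eq_mul k, reducedSeries]
  ring

theorem branchSeries_mul_sqrtSeries (r : ℕ) :
    X * branchSeries r * sqrtSeries = reducedSeries r := by
  have h := treeSeries_eq (fun t => (numBranches r t : ℝ))
  rw [sqrtSeries, branchSeries, catalanSeries]
  cases r with
  | zero =>
    have h1 : ∀ a b, (numBranches 0 (node () a b) : ℝ) =
        (numBranches 0 a : ℝ) * 1 + 1 * (numBranches 0 b : ℝ) := by
      intro a b; simp [numBranches_node]
    simp only [h1] at h
    rw [pairSeries_add, pairSeries_mul (fun t => (numBranches 0 t : ℝ)) (fun _ => 1),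
      pairSeries_mul (fun _ => 1) (fun t => (numBranches 0 t : ℝ)), numBranches_nil] at h
    simp only [if_true, Nat.cast_one, map_one] at h
    rw [reducedSeries]
    linear_combination X * h
  | succ r =>
    have h1 : ∀ a b, (numBranches (r + 1) (node () a b) : ℝ) =
        ((numBranches (r + 1) a : ℝ) * 1 + 1 * (numBranches (r + 1) b : ℝ)) +
          regIndicator r a * regIndicator r b := by
      intro a b
      rw [numBranches_node, regIndicator, regIndicator]
      push_cast
      split_ifs <;> first | omega | simp
    simp only [h1] at h
    rw [pairSeries_add, pairSeries_add,
      pairSeries_mul (fun t => (numBranches (r + 1) t : ℝ)) (fun _ => 1),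
      pairSeries_mul (fun _ => 1) (fun t => (numBranches (r + 1) t : ℝ)),
      pairSeries_mul, numBranches_nil] at h
    simp only [Nat.succ_ne_zero, if_false, Nat.cast_zero, map_zero] at h
    rw [reducedSeries, regSeries]
    linear_combination X * h

/-- The factorial moment is chosen because the extra branch at the root drops out: it occurs only if
neither subtree has an `r`-branch, and a single branch forms no pair. Only the cross term `2 * a *
b` of the two subtree counts remains as a source. -/
theorem branchPairSeries_mul_sqrtSeries (r : ℕ) :
    branchPairSeries r * sqrtSeries = 2 * X * branchSeries r ^ 2 := by
  have h := treeSeries_eq (fun t => (numBranches r t : ℝ) * (numBranches r t - 1))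
  have h1 : ∀ a b, (numBranches r (node () a b) : ℝ) * (numBranches r (node () a b) - 1) =
      ((numBranches r a : ℝ) * (numBranches r a - 1)) * 1 +
        (1 * ((numBranches r b : ℝ) * (numBranches r b - 1)) +
          (2 * (numBranches r a : ℝ)) * numBranches r b) := by
    intro a b
    rw [numBranches_node]
    split_ifs with h
    · rw [numBranches_eq_zero (show reg a < r by omega),
        numBranches_eq_zero (show reg b < r by omega)]
      simp
    · push_cast
      ring
  simp only [h1] at h
  rw [pairSeries_add, pairSeries_add,
    pairSeries_mul (fun t => (numBranches r t : ℝ) * (numBranches r t - 1)) (fun _ => 1),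
    pairSeries_mul (fun _ => 1) (fun t => (numBranches r t : ℝ) * (numBranches r t - 1)),
    pairSeries_mul (fun t => 2 * (numBranches r t : ℝ)) (fun t => (numBranches r t : ℝ)),
    treeSeries_smul, numBranches_nil] at h
  have h0 : (((if r = 0 then 1 else 0 : ℕ) : ℝ)) * (((if r = 0 then 1 else 0 : ℕ) : ℝ) - 1) = 0 := by
    split_ifs <;> simp
  rw [h0, map_zero, map_ofNat] at h
  rw [branchPairSeries, branchSeries, sqrtSeries, catalanSeries]
  linear_combination h

/-! ### A weighted convolution algebra -/

theorem weight_add_le (i j : ℕ) :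
    ((i + j : ℕ) + 1 : ℝ) ^ 5 / 4 ^ (i + j) ≤
      (((i : ℝ) + 1) ^ 5 / 4 ^ i) * (((j : ℝ) + 1) ^ 5 / 4 ^ j) := by
  rw [div_mul_div_comm, ← mul_pow, ← pow_add]
  gcongr
  push_cast
  nlinarith [mul_nonneg (Nat.cast_nonneg (α := ℝ) i) (Nat.cast_nonneg (α := ℝ) j)]

/-- The coefficients of `f` are absolutely summable with respect to the submultiplicative weight
`(n + 1) ^ 5 / 4 ^ n`. -/
def WeightedSummable (f : PowerSeries ℝ) : Prop :=
  Summable fun n : ℕ => |coeff n f| * (((n : ℝ) + 1) ^ 5 / 4 ^ n)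

theorem WeightedSummable.mul {f g : PowerSeries ℝ} (hf : WeightedSummable f)
    (hg : WeightedSummable g) : WeightedSummable (f * g) := by
  have h := summable_sum_mul_antidiagonal_of_summable_mul
    (Summable.mul_of_nonneg hf hg (fun n => by positivity) (fun n => by positivity))
  refine Summable.of_nonneg_of_le (fun n => by positivity) (fun n => ?_) h
  rw [coeff_mul]
  calc _ ≤ (∑ p ∈ antidiagonal n, |coeff p.1 f| * |coeff p.2 g|) *
        (((n : ℝ) + 1) ^ 5 / 4 ^ n) := by
        gcongr
        exact (abs_sum_le_sum_abs _ _).trans_eq (sum_congr rfl fun _ _ => abs_mul _ _)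
    _ ≤ _ := by
        rw [sum_mul]
        refine sum_le_sum fun p hp => ?_
        rw [HasAntidiagonal.mem_antidiagonal] at hp
        rw [← hp]
        calc _ ≤ |coeff p.1 f| * |coeff p.2 g| *
              ((((p.1 : ℝ) + 1) ^ 5 / 4 ^ p.1) * (((p.2 : ℝ) + 1) ^ 5 / 4 ^ p.2)) :=
              mul_le_mul_of_nonneg_left (weight_add_le _ _) (by positivity)
          _ = _ := by ring

theorem WeightedSummable.add {f g : PowerSeries ℝ} (hf : WeightedSummable f)
    (hg : WeightedSummable g) : WeightedSummable (f + g) := by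
  refine Summable.of_nonneg_of_le (fun n => by positivity) (fun n => ?_) (Summable.add hf hg)
  rw [← add_mul, map_add]
  exact mul_le_mul_of_nonneg_right (abs_add_le _ _) (by positivity)

theorem weightedSummable_C (c : ℝ) : WeightedSummable (C c) := by
  refine summable_of_ne_finset_zero (s := {0}) fun n hn => ?_
  rw [coeff_C, if_neg (by simpa using hn), abs_zero, zero_mul]

/-- The algebra of the power series with weighted summable coefficients. -/
def weightedAlgebra : Subalgebra ℝ (PowerSeries ℝ) where
  carrier := {f | WeightedSummable f}
  mul_mem' := WeightedSummable.mul
  add_mem' := WeightedSummable.add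
  algebraMap_mem' := weightedSummable_C

theorem mem_weightedAlgebra {f : PowerSeries ℝ} : f ∈ weightedAlgebra ↔ WeightedSummable f :=
  Iff.rfl

theorem C_mem_weightedAlgebra (c : ℝ) : C c ∈ weightedAlgebra :=
  weightedAlgebra.algebraMap_mem c

theorem X_mem_weightedAlgebra : (X : PowerSeries ℝ) ∈ weightedAlgebra := by
  rw [mem_weightedAlgebra]
  refine summable_of_ne_finset_zero (s := {1}) fun n hn => ?_
  rw [coeff_X, if_neg (by simpa using hn)]
  simp

theorem ofNat_mem_weightedAlgebra (n : ℕ) [n.AtLeastTwo] :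
    (ofNat(n) : PowerSeries ℝ) ∈ weightedAlgebra :=
  ofNat_mem weightedAlgebra n

theorem geometric_mem_weightedAlgebra {a : ℝ} (h0 : 0 ≤ a) (h4 : a < 4) :
    PowerSeries.mk (fun n => a ^ n) ∈ weightedAlgebra := by
  have h1 : ‖a / 4‖ < 1 := by
    rw [Real.norm_eq_abs, abs_of_nonneg (by positivity)]
    linarith
  have h : Summable fun n : ℕ => (((n : ℝ) + 1) ^ 5) * (a / 4) ^ n := by
    have e : ∀ n : ℕ, (((n : ℝ) + 1) ^ 5) * (a / 4) ^ n = (n : ℝ) ^ 5 * (a / 4) ^ n +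
        5 * ((n : ℝ) ^ 4 * (a / 4) ^ n) + 10 * ((n : ℝ) ^ 3 * (a / 4) ^ n) +
        10 * ((n : ℝ) ^ 2 * (a / 4) ^ n) + 5 * ((n : ℝ) ^ 1 * (a / 4) ^ n) +
        (n : ℝ) ^ 0 * (a / 4) ^ n := fun n => by ring
    have s := fun k => summable_pow_mul_geometric_of_norm_lt_one k h1
    rw [funext e]
    exact (((((s 5).add ((s 4).mul_left 5)).add ((s 3).mul_left 10)).add
      ((s 2).mul_left 10)).add ((s 1).mul_left 5)).add (s 0)
  rw [mem_weightedAlgebra]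
  refine h.congr fun n => ?_
  rw [coeff_mk, abs_of_nonneg (by positivity), div_pow]
  ring

theorem one_sub_mul_geometric (a : ℝ) :
    (1 - C a * X) * PowerSeries.mk (fun n => a ^ n) = 1 := by
  ext n
  rw [sub_mul, one_mul, mul_assoc, map_sub, coeff_C_mul]
  cases n with
  | zero => simp
  | succ n => rw [coeff_succ_X_mul, coeff_mk, coeff_mk, coeff_one, if_neg (Nat.succ_ne_zero n)]; ring

/-- Invertibility of `S_{k+1}` is the case `c = 0`, but the induction needs a whole family of `c`.
Multiplied by `S_{k+1}`, the factor `S_{k+2} - c B_{k+1}` becomes `S_{k+1} ^ 2 - (2 + c) B_k ^ 2`, a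
difference of squares with factors `S_{k+1} ∓ √(2 + c) B_k`. The interval `(-2, 2)` is stable under
`c ↦ ±√(2 + c)`, as in the half-angle formula for `c = 2 cos θ`. -/
theorem regSeries_lowRegSeries_mem (k : ℕ) :
    regSeries k ∈ weightedAlgebra ∧ lowRegSeries k ∈ weightedAlgebra ∧
      ∀ c : ℝ, -2 < c → c < 2 →
        ∃ g ∈ weightedAlgebra, (lowRegSeries (k + 1) - C c * regSeries k) * g = 1 := by
  induction k with
  | zero =>
    -- `S_1 - c B_0 = 1 - (2 + c) X` is inverted by a geometric series of ratio `2 + c < 4`.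
    refine ⟨?_, ?_, fun c hc hc' => ⟨_, geometric_mem_weightedAlgebra (a := 2 + c)
      (by linarith) (by linarith), ?_⟩⟩
    · rw [regSeries_zero]; exact X_mem_weightedAlgebra
    · simp [lowRegSeries, one_mem]
    · rw [← one_sub_mul_geometric (2 + c), regSeries_zero]
      simp only [lowRegSeries, range_one, sum_singleton, zero_add, regSeries_zero, map_add,
        map_ofNat]
      ring
  | succ k ih =>
    obtain ⟨hb, hs, hu⟩ := ih
    have hs' : lowRegSeries (k + 1) ∈ weightedAlgebra := by
      rw [lowRegSeries_succ]
      exact sub_mem hs (mul_mem (ofNat_mem_weightedAlgebra 2) hb)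
    refine ⟨?_, hs', fun c hc hc' => ?_⟩
    · obtain ⟨g, hg, h⟩ := hu 0 (by norm_num) (by norm_num)
      rw [map_zero, zero_mul, sub_zero] at h
      have : regSeries (k + 1) = regSeries k ^ 2 * g := by
        rw [← regSeries_succ_mul, mul_assoc, h, mul_one]
      rw [this]
      exact mul_mem (pow_mem hb 2) hg
    · set d := Real.sqrt (2 + c) with hd
      have hd2 : d ^ 2 = 2 + c := Real.sq_sqrt (by linarith)
      have hd0 : 0 ≤ d := Real.sqrt_nonneg _
      have hdlt : d < 2 := by nlinarith
      obtain ⟨g, hg, h⟩ := hu d (by linarith) hdlt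
      obtain ⟨g', hg', h'⟩ := hu (-d) (by linarith) (by linarith)
      refine ⟨lowRegSeries (k + 1) * g * g', mul_mem (mul_mem hs' hg) hg', ?_⟩
      have hC : (C d : PowerSeries ℝ) ^ 2 = 2 + C c := by
        rw [← map_pow, hd2, map_add, map_ofNat]
      have e : (lowRegSeries (k + 1 + 1) - C c * regSeries (k + 1)) * lowRegSeries (k + 1) =
          (lowRegSeries (k + 1) - C d * regSeries k) *
            (lowRegSeries (k + 1) - C (-d) * regSeries k) := by
        rw [map_neg, lowRegSeries_succ (k + 1)]
        linear_combination (-(2 + C c)) * regSeries_succ_mul k + regSeries k ^ 2 * hC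
      calc _ = ((lowRegSeries (k + 1 + 1) - C c * regSeries (k + 1)) * lowRegSeries (k + 1)) *
            g * g' := by ring
        _ = ((lowRegSeries (k + 1) - C d * regSeries k) * g) *
            ((lowRegSeries (k + 1) - C (-d) * regSeries k) * g') := by rw [e]; ring
        _ = 1 := by rw [h, h', one_mul]

theorem exists_lowRegSeries_inv (k : ℕ) :
    ∃ g ∈ weightedAlgebra, lowRegSeries k * g = 1 := by
  cases k with
  | zero => exact ⟨1, one_mem _, by simp [lowRegSeries]⟩
  | succ k =>
    obtain ⟨g, hg, h⟩ := (regSeries_lowRegSeries_mem k).2.2 0 (by norm_num) (by norm_num)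
    exact ⟨g, hg, by simpa using h⟩

/-! ### Expansion at the dominant singularity -/

theorem one_sub_four_X_mem : (1 - 4 * X : PowerSeries ℝ) ∈ weightedAlgebra :=
  sub_mem (one_mem _) (mul_mem (ofNat_mem_weightedAlgebra 4) X_mem_weightedAlgebra)

/-- The polynomial `c 0 + c 1 ε + c 2 ε ^ 2 + c 3 ε ^ 3` in `ε = 1 - 4 X`. -/
noncomputable def singularCubic (c : Fin 4 → ℝ) : PowerSeries ℝ :=
  C (c 0) + C (c 1) * (1 - 4 * X) + C (c 2) * (1 - 4 * X) ^ 2 + C (c 3) * (1 - 4 * X) ^ 3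

/-- The coefficients of the expansion of `reducedSeries r` in powers of `1 - 4 X`, for
`q = 4 ^ r`. -/
noncomputable def singularCoeff (q : ℝ) : Fin 4 → ℝ :=
  ![1 / (4 * q), -(1 / (6 * q) + 1 / 12), q / 60 - 1 / (60 * q),
    -8 / (945 * q) + q / 90 - q ^ 2 / 378]

theorem singularCubic_mem (c : Fin 4 → ℝ) : singularCubic c ∈ weightedAlgebra := by
  have hC := C_mem_weightedAlgebra
  have he := one_sub_four_X_mem
  exact add_mem (add_mem (add_mem (hC _) (mul_mem (hC _) he)) (mul_mem (hC _) (pow_mem he 2)))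
    (mul_mem (hC _) (pow_mem he 3))

/-- The hypotheses say that the coefficients of `ε ^ 0` to `ε ^ 3` cancel in `p ^ 2 - p' (ε + 4 p)`;
`H` collects those of `ε ^ 4` to `ε ^ 6`. -/
theorem exists_cubic_remainder {a b : Fin 4 → ℝ} (h0 : a 0 ^ 2 = 4 * (b 0 * a 0))
    (h1 : 2 * (a 0 * a 1) = b 0 + 4 * (b 0 * a 1 + b 1 * a 0))
    (h2 : 2 * (a 0 * a 2) + a 1 ^ 2 = b 1 + 4 * (b 0 * a 2 + b 1 * a 1 + b 2 * a 0))
    (h3 : 2 * (a 0 * a 3 + a 1 * a 2) =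
      b 2 + 4 * (b 0 * a 3 + b 1 * a 2 + b 2 * a 1 + b 3 * a 0)) :
    ∃ H ∈ weightedAlgebra, singularCubic a ^ 2 -
      singularCubic b * ((1 - 4 * X) + 4 * singularCubic a) = (1 - 4 * X) ^ 4 * H := by
  have hC := C_mem_weightedAlgebra
  have he := one_sub_four_X_mem
  refine ⟨C (2 * (a 1 * a 3) + a 2 ^ 2 - (b 3 + 4 * (b 1 * a 3 + b 2 * a 2 + b 3 * a 1))) +
    C (2 * (a 2 * a 3) - 4 * (b 2 * a 3 + b 3 * a 2)) * (1 - 4 * X) +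
    C (a 3 ^ 2 - 4 * (b 3 * a 3)) * (1 - 4 * X) ^ 2,
    add_mem (add_mem (hC _) (mul_mem (hC _) he)) (mul_mem (hC _) (pow_mem he 2)), ?_⟩
  replace h0 := congrArg (C (R := ℝ)) h0
  replace h1 := congrArg (C (R := ℝ)) h1
  replace h2 := congrArg (C (R := ℝ)) h2
  replace h3 := congrArg (C (R := ℝ)) h3
  simp only [map_add, map_sub, map_mul, map_pow, map_ofNat] at h0 h1 h2 h3 ⊢
  simp only [singularCubic]
  generalize (1 - 4 * X : PowerSeries ℝ) = e
  linear_combination h0 + e * h1 + e ^ 2 * h2 + e ^ 3 * h3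

theorem reducedSeries_expansion (r : ℕ) :
    ∃ H ∈ weightedAlgebra,
      reducedSeries r = singularCubic (singularCoeff (4 ^ r)) + (1 - 4 * X) ^ 4 * H := by
  induction r with
  | zero =>
    refine ⟨0, zero_mem _, ?_⟩
    have h : singularCoeff (4 ^ 0) = ![1 / 4, -(1 / 4), 0, 0] := by
      rw [singularCoeff]; norm_num
    have h4 : (4 : PowerSeries ℝ) * C (1 / 4 : ℝ) = 1 := by
      rw [← map_ofNat (C (R := ℝ)) 4, ← map_mul]; norm_num
    rw [h]
    simp only [reducedSeries, singularCubic, Matrix.cons_val, map_neg, map_zero]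
    linear_combination (-X) * h4
  | succ r ih =>
    obtain ⟨H, hH, e⟩ := ih
    obtain ⟨g, hg, hgu⟩ := exists_lowRegSeries_inv r
    have hq : (4 : ℝ) ^ r ≠ 0 := by positivity
    obtain ⟨K, hK, eK⟩ : ∃ K ∈ weightedAlgebra, singularCubic (singularCoeff (4 ^ r)) ^ 2 -
        singularCubic (singularCoeff (4 ^ (r + 1))) *
          ((1 - 4 * X) + 4 * singularCubic (singularCoeff (4 ^ r))) = (1 - 4 * X) ^ 4 * K := by
      apply exists_cubic_remainder <;>
      · simp only [singularCoeff, Matrix.cons_val, pow_succ (4 : ℝ) r]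
        generalize (4 : ℝ) ^ r = q at hq
        first | (field_simp; done) | (field_simp; ring)
    set p := singularCubic (singularCoeff (4 ^ r)) with hp
    set p' := singularCubic (singularCoeff (4 ^ (r + 1))) with hp'
    have hpm : p ∈ weightedAlgebra := singularCubic_mem _
    have hpm' : p' ∈ weightedAlgebra := singularCubic_mem _
    have he := one_sub_four_X_mem
    have h2 := ofNat_mem_weightedAlgebra 2
    have h4 := ofNat_mem_weightedAlgebra 4
    -- Insert `V_r = p + ε ^ 4 H` into `V_r ^ 2 - p' (ε + 4 V_r)`, which equals `(V_{r+1} - p') S_r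
    -- ^ 2`, and divide by `S_r ^ 2` using its inverse `g ^ 2`.
    refine ⟨g ^ 2 * (K + 2 * p * H + (1 - 4 * X) ^ 4 * H ^ 2 - 4 * p' * H),
      mul_mem (pow_mem hg 2) (sub_mem (add_mem (add_mem hK (mul_mem (mul_mem h2 hpm) hH))
        (mul_mem (pow_mem he 4) (pow_mem hH 2))) (mul_mem (mul_mem h4 hpm') hH)), ?_⟩
    have hs := lowRegSeries_sq r
    have hV := reducedSeries_succ_mul r
    generalize (1 - 4 * X : PowerSeries ℝ) = ε at *
    have key : (reducedSeries (r + 1) - p') * lowRegSeries r ^ 2 =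
        ε ^ 4 * (K + 2 * p * H + ε ^ 4 * H ^ 2 - 4 * p' * H) := by
      rw [sub_mul, hV, hs, e]
      linear_combination eK
    have hg2 : lowRegSeries r ^ 2 * g ^ 2 = 1 := by rw [← mul_pow, hgu, one_pow]
    linear_combination g ^ 2 * key - (reducedSeries (r + 1) - p') * hg2

/-! ### Coefficients of half-integral powers of `1 - 4 X` -/

theorem four_mul_centralBinom (n : ℕ) :
    4 * (Nat.centralBinom n : ℝ) = 2 * (n + 1) / (2 * n + 1) * Nat.centralBinom (n + 1) := by
  have h : ((n : ℝ) + 1) * Nat.centralBinom (n + 1) = 2 * (2 * n + 1) * Nat.centralBinom n := by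
    exact_mod_cast Nat.succ_mul_centralBinom_succ n
  have : (2 * (n : ℝ) + 1) ≠ 0 := by positivity
  field_simp
  linear_combination (-2) * h

theorem two_mul_sub_odd_ne_zero (n j : ℕ) : (2 * (n : ℝ) - (2 * j - 1)) ≠ 0 := by
  intro h
  have : (2 * (n : ℤ) - (2 * j - 1)) = 0 := by exact_mod_cast h
  omega

/-- Controls the denominators of `coeffRatio` uniformly in `n`, so that each further factor `ε`
gains one power of `n + 1`. -/
theorem le_abs_two_mul_sub_odd (n j : ℕ) :
    ((n : ℝ) + 1) / (j + 1) ≤ |2 * (n : ℝ) - (2 * j - 1)| := by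
  rw [div_le_iff₀ (by positivity)]
  rcases lt_or_ge n j with h | h
  · have h' : (n : ℝ) + 1 ≤ j := by exact_mod_cast h
    rw [abs_of_nonpos (by linarith)]
    nlinarith [Nat.cast_nonneg (α := ℝ) n]
  · have h' : (j : ℝ) ≤ n := by exact_mod_cast h
    rw [abs_of_nonneg (by linarith)]
    nlinarith [Nat.cast_nonneg (α := ℝ) j]

theorem coeff_one_sub_four_X_mul {f : PowerSeries ℝ} {φ ψ : ℕ → ℝ}
    (hf : ∀ n, coeff n f = φ n * Nat.centralBinom n) (h0 : ψ 0 = φ 0)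
    (hs : ∀ n : ℕ, ψ (n + 1) = φ (n + 1) - φ n * (2 * (n + 1) / (2 * n + 1))) (n : ℕ) :
    coeff n ((1 - 4 * X) * f) = ψ n * Nat.centralBinom n := by
  rw [sub_mul, one_mul, mul_assoc, map_sub, ← map_ofNat (C (R := ℝ)) 4, coeff_C_mul]
  cases n with
  | zero => simp [hf, h0]
  | succ n =>
    rw [coeff_succ_X_mul, hf, hf, hs]
    linear_combination (-φ n) * four_mul_centralBinom n

/-- The expansion of `(1 - 4 X) ^ (-3 / 2)`. -/
noncomputable def negThreeHalvesSeries : PowerSeries ℝ :=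
  PowerSeries.mk fun n => (2 * n + 1) * Nat.centralBinom n

/-- The coefficient of `X ^ n` in `(1 - 4 X) ^ (j - 3 / 2)`, divided by that in
`(1 - 4 X) ^ (-1 / 2)`. -/
noncomputable def coeffRatio (j : ℕ) (n : ℕ) : ℝ :=
  match j with
  | 0 => 2 * n + 1
  | j + 1 => coeffRatio j n * -((2 * j - 1) / (2 * n - (2 * j - 1)))

theorem coeffRatio_zero_right (j : ℕ) : coeffRatio j 0 = 1 := by
  induction j with
  | zero => simp [coeffRatio]
  | succ j ih =>
    have h := two_mul_sub_odd_ne_zero 0 j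
    rw [coeffRatio, ih]
    field_simp
    push_cast
    ring

/-- The ratio of consecutive coefficients of a power of `ε`, compared with the same ratio for the
central binomial coefficients. -/
theorem coeffRatio_succ_right (j n : ℕ) :
    coeffRatio j (n + 1) * (2 * n + 1) = coeffRatio j n * (2 * n + 3 - 2 * j) := by
  induction j with
  | zero => simp only [coeffRatio]; push_cast; ring
  | succ j ih =>
    have h := two_mul_sub_odd_ne_zero n j
    have h' := two_mul_sub_odd_ne_zero (n + 1) j
    rw [coeffRatio, coeffRatio]
    push_cast at h' ⊢
    field_simp
    linear_combination (-(2 * (j : ℝ) - 1) * (2 * n - (2 * j - 1))) * ih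

theorem coeff_pow_mul_negThreeHalvesSeries (j n : ℕ) :
    coeff n ((1 - 4 * X) ^ j * negThreeHalvesSeries) = coeffRatio j n * Nat.centralBinom n := by
  induction j generalizing n with
  | zero => rw [pow_zero, one_mul, negThreeHalvesSeries, coeff_mk, coeffRatio]
  | succ j ih =>
    rw [pow_succ', mul_assoc]
    refine coeff_one_sub_four_X_mul ih ?_ (fun n => ?_) n
    · rw [coeffRatio_zero_right, coeffRatio_zero_right]
    · have h := two_mul_sub_odd_ne_zero (n + 1) j
      have h' : (2 * (n : ℝ) + 1) ≠ 0 := by positivity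
      have e := coeffRatio_succ_right j n
      rw [coeffRatio]
      push_cast at h ⊢
      field_simp
      linear_combination (-2 * ((n : ℝ) + 1)) * e

theorem exists_abs_coeffRatio_le (j : ℕ) :
    ∃ K : ℝ, 0 ≤ K ∧ ∀ n : ℕ, |coeffRatio j n| ≤ K * ((n + 1) / ((n : ℝ) + 1) ^ j) := by
  induction j with
  | zero =>
    refine ⟨2, by norm_num, fun n => ?_⟩
    rw [coeffRatio, abs_of_nonneg (by positivity), pow_zero, div_one]
    linarith
  | succ j ih =>
    obtain ⟨K, hK, h⟩ := ih
    refine ⟨K * (|2 * (j : ℝ) - 1| * (j + 1)), by positivity, fun n => ?_⟩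
    rw [coeffRatio, abs_mul, abs_neg, abs_div]
    have h1 := le_abs_two_mul_sub_odd n j
    calc _ ≤ K * ((n + 1) / ((n : ℝ) + 1) ^ j) *
          (|2 * (j : ℝ) - 1| / (((n : ℝ) + 1) / (j + 1))) := by
          gcongr
          exact h n
      _ = _ := by
          field_simp
          ring

theorem centralBinom_mul_four_pow_le (i j : ℕ) :
    ((i : ℝ) + 1) * Nat.centralBinom i * 4 ^ j ≤
      ((i + j : ℕ) + 1 : ℝ) * Nat.centralBinom (i + j) := by
  induction j with
  | zero => simp
  | succ j ih =>
    have h := four_mul_centralBinom (i + j)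
    rw [← add_assoc, pow_succ, ← mul_assoc]
    calc _ ≤ ((i + j : ℕ) + 1 : ℝ) * Nat.centralBinom (i + j) * 4 := by gcongr
      _ = ((i + j : ℕ) + 1 : ℝ) * (2 * ((i + j : ℕ) + 1) / (2 * (i + j : ℕ) + 1)) *
          Nat.centralBinom (i + j + 1) := by rw [mul_assoc, mul_comm _ (4 : ℝ), h]; ring
      _ ≤ _ := by
          gcongr
          generalize i + j = m
          rw [← mul_div_assoc, div_le_iff₀ (by positivity)]
          push_cast
          nlinarith [Nat.cast_nonneg (α := ℝ) m]

/-- This fixes the exponent 5 of the weight. Monotonicity of `(n + 1) * centralBinom n / 4 ^ n`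
costs one factor `j + 1`, and `i + j + 1 ≤ (i + 1) (j + 1)` costs `k ≤ 4` more. -/
theorem centralBinom_div_le {k : ℕ} (hk : k ≤ 4) (i j : ℕ) :
    (Nat.centralBinom i : ℝ) / ((i : ℝ) + 1) ^ k ≤
      Nat.centralBinom (i + j) / ((i + j : ℕ) + 1 : ℝ) ^ k * (((j : ℝ) + 1) ^ 5 / 4 ^ j) := by
  have h := centralBinom_mul_four_pow_le i j
  have hij : ((i + j : ℕ) + 1 : ℝ) ≤ (i + 1) * (j + 1) := by
    push_cast
    nlinarith [mul_nonneg (Nat.cast_nonneg (α := ℝ) i) (Nat.cast_nonneg (α := ℝ) j)]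
  have h1 : (Nat.centralBinom i : ℝ) * 4 ^ j ≤ (j + 1) * Nat.centralBinom (i + j) := by
    have h2 : ((i : ℝ) + 1) * (Nat.centralBinom i * 4 ^ j) ≤
        (i + 1) * ((j + 1) * Nat.centralBinom (i + j)) := by
      rw [← mul_assoc, ← mul_assoc]
      exact h.trans (by gcongr)
    exact le_of_mul_le_mul_left h2 (by positivity)
  rw [div_mul_div_comm, div_le_div_iff₀ (by positivity) (by positivity)]
  have h5 : ((j : ℝ) + 1) ^ (k + 1) ≤ (j + 1) ^ 5 :=
    pow_le_pow_right₀ (by linarith [Nat.cast_nonneg (α := ℝ) j]) (by omega)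
  calc _ = (Nat.centralBinom i : ℝ) * 4 ^ j * ((i + j : ℕ) + 1 : ℝ) ^ k := by ring
    _ ≤ ((j + 1) * Nat.centralBinom (i + j)) * ((i + 1) * (j + 1)) ^ k := by gcongr
    _ = Nat.centralBinom (i + j) * ((j : ℝ) + 1) ^ (k + 1) * ((i : ℝ) + 1) ^ k := by
        rw [mul_pow, pow_succ]; ring
    _ ≤ _ := by gcongr

/-- The substitute for a transfer theorem: in the convolution, shifting the bound for `f` from index
`i` to `n` costs exactly the weight at `n - i`, so the weighted norm of `g` bounds the sum. -/
theorem exists_abs_coeff_mul_le {f g : PowerSeries ℝ} {k : ℕ} (hk : k ≤ 4) {K : ℝ} (hK : 0 ≤ K)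
    (hf : ∀ n, |coeff n f| ≤ K * (Nat.centralBinom n / ((n : ℝ) + 1) ^ k))
    (hg : g ∈ weightedAlgebra) :
    ∃ K' : ℝ, 0 ≤ K' ∧
      ∀ n, |coeff n (f * g)| ≤ K' * (Nat.centralBinom n / ((n : ℝ) + 1) ^ k) := by
  rw [mem_weightedAlgebra] at hg
  refine ⟨K * ∑' n : ℕ, |coeff n g| * (((n : ℝ) + 1) ^ 5 / 4 ^ n),
    mul_nonneg hK (tsum_nonneg fun n => by positivity), fun n => ?_⟩
  rw [coeff_mul]
  calc _ ≤ ∑ p ∈ antidiagonal n, K * (Nat.centralBinom n / ((n : ℝ) + 1) ^ k) *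
        (|coeff p.2 g| * (((p.2 : ℝ) + 1) ^ 5 / 4 ^ p.2)) := by
        refine (abs_sum_le_sum_abs _ _).trans (sum_le_sum fun p hp => ?_)
        rw [HasAntidiagonal.mem_antidiagonal] at hp
        rw [abs_mul, ← hp]
        calc _ ≤ K * (Nat.centralBinom (p.1 + p.2) / ((p.1 + p.2 : ℕ) + 1 : ℝ) ^ k *
              (((p.2 : ℝ) + 1) ^ 5 / 4 ^ p.2)) * |coeff p.2 g| := by
              gcongr
              exact (hf p.1).trans (mul_le_mul_of_nonneg_left (centralBinom_div_le hk _ _) hK)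
          _ = _ := by ring
    _ = K * (Nat.centralBinom n / ((n : ℝ) + 1) ^ k) *
        ∑ j ∈ range (n + 1), |coeff j g| * (((j : ℝ) + 1) ^ 5 / 4 ^ j) := by
        rw [← mul_sum, Finset.Nat.sum_antidiagonal_eq_sum_range_succ_mk,
          ← sum_range_reflect]
        congr 1
        refine sum_congr rfl fun j hj => ?_
        rw [mem_range] at hj
        have : n - (n + 1 - 1 - j) = j := by omega
        simp only [this]
    _ ≤ K * (Nat.centralBinom n / ((n : ℝ) + 1) ^ k) *
        ∑' n : ℕ, |coeff n g| * (((n : ℝ) + 1) ^ 5 / 4 ^ n) := by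
        gcongr
        exact Summable.sum_le_tsum _ (fun j _ => by positivity) hg
    _ = _ := by ring

/-! ### Moments -/

theorem coeff_catalanSeries (n : ℕ) : coeff n catalanSeries = catalan n := by
  rw [catalanSeries, treeSeries, coeff_mk, sum_const, treesOfNumNodesEq_card_eq_catalan,
    nsmul_one]

theorem centralBinom_succ_eq_catalan (n : ℕ) :
    (Nat.centralBinom (n + 1) : ℝ) = 2 * (2 * n + 1) * catalan n := by
  have h : ((n : ℝ) + 1) * Nat.centralBinom (n + 1) = 2 * (2 * n + 1) * Nat.centralBinom n := by
    exact_mod_cast Nat.succ_mul_centralBinom_succ n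
  have h' : ((n : ℝ) + 1) * catalan n = Nat.centralBinom n := by
    exact_mod_cast succ_mul_catalan_eq_centralBinom n
  have h0 : ((n : ℝ) + 1) ≠ 0 := by positivity
  apply mul_left_cancel₀ h0
  rw [h, ← h']
  ring

theorem one_sub_four_X_ne_zero : (1 - 4 * X : PowerSeries ℝ) ≠ 0 := by
  intro h
  have := congrArg (coeff 0) h
  simp at this

theorem sqrtSeries_eq : sqrtSeries = (1 - 4 * X) ^ 2 * negThreeHalvesSeries := by
  ext n
  rw [coeff_pow_mul_negThreeHalvesSeries, sqrtSeries, mul_assoc, map_sub,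
    ← map_ofNat (C (R := ℝ)) 2, coeff_C_mul]
  cases n with
  | zero => simp [coeffRatio_zero_right]
  | succ n =>
    rw [coeff_succ_X_mul, coeff_catalanSeries, centralBinom_succ_eq_catalan, coeff_one,
      if_neg (Nat.succ_ne_zero n)]
    simp only [coeffRatio]
    have h : (2 * (n : ℝ) + 1) ≠ 0 := by positivity
    have h1 : (2 * ((n : ℝ) + 1) + 1) ≠ 0 := by positivity
    push_cast
    have h2 : (2 * ((n : ℝ) + 1) - (2 * 1 - 1)) = 2 * n + 1 := by ring
    have h3 : (2 * ((n : ℝ) + 1) - (2 * 0 - 1)) = 2 * (n + 1) + 1 := by ring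
    rw [h2, h3]
    field_simp
    ring

/-- Identifies `ε * negThreeHalvesSeries` as `ε ^ (-1/2)`. -/
theorem sqrtSeries_mul_inv : sqrtSeries * ((1 - 4 * X) * negThreeHalvesSeries) = 1 := by
  apply mul_left_cancel₀ one_sub_four_X_ne_zero
  linear_combination sqrtSeries_sq - sqrtSeries * sqrtSeries_eq

theorem X_mul_branchSeries (r : ℕ) :
    X * branchSeries r = (1 - 4 * X) * negThreeHalvesSeries * reducedSeries r := by
  rw [← branchSeries_mul_sqrtSeries]
  linear_combination (-X * branchSeries r) * sqrtSeries_mul_inv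

theorem X_mul_branchPairSeries (r : ℕ) :
    X * branchPairSeries r = 2 * (negThreeHalvesSeries * reducedSeries r ^ 2) := by
  have h1 := branchPairSeries_mul_sqrtSeries r
  have h2 := X_mul_branchSeries r
  have h3 := sqrtSeries_mul_inv
  have h4 := sqrtSeries_eq
  set E := (1 - 4 * X) * negThreeHalvesSeries with hE
  have h5 : (1 - 4 * X) * E ^ 2 = 1 := by
    linear_combination h3 - E * h4 + (1 - 4 * X) * E * hE
  calc X * branchPairSeries r = X * (branchPairSeries r * sqrtSeries) * E := by
        linear_combination (-X * branchPairSeries r) * h3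
    _ = 2 * (X * branchSeries r) ^ 2 * E := by rw [h1]; ring
    _ = 2 * (((1 - 4 * X) * E ^ 2) * negThreeHalvesSeries * reducedSeries r ^ 2) := by
        rw [h2, hE]; ring
    _ = _ := by rw [h5]; ring

theorem expectation_eq (n : ℕ) (f : BinaryTree Unit → ℝ) :
    expectation n f = coeff (n + 1) (X * treeSeries f) / catalan n := by
  rw [coeff_succ_X_mul, treeSeries, coeff_mk, expectation, treesOfNumNodesEq_card_eq_catalan]

theorem catalan_pos (n : ℕ) : (0 : ℝ) < catalan n := by
  have h := centralBinom_succ_eq_catalan n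
  have h1 : (0 : ℝ) < Nat.centralBinom (n + 1) := by exact_mod_cast Nat.centralBinom_pos _
  rw [h] at h1
  exact pos_of_mul_pos_right h1 (by positivity)

theorem coeff_singularCubic_mul (c : Fin 4 → ℝ) (j n : ℕ) :
    coeff n ((1 - 4 * X) ^ j * negThreeHalvesSeries * singularCubic c) =
      (c 0 * coeffRatio j n + c 1 * coeffRatio (j + 1) n + c 2 * coeffRatio (j + 2) n +
        c 3 * coeffRatio (j + 3) n) * Nat.centralBinom n := by
  have h : (1 - 4 * X) ^ j * negThreeHalvesSeries * singularCubic c =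
      C (c 0) * ((1 - 4 * X) ^ j * negThreeHalvesSeries) +
      C (c 1) * ((1 - 4 * X) ^ (j + 1) * negThreeHalvesSeries) +
      C (c 2) * ((1 - 4 * X) ^ (j + 2) * negThreeHalvesSeries) +
      C (c 3) * ((1 - 4 * X) ^ (j + 3) * negThreeHalvesSeries) := by
    rw [singularCubic]; ring
  rw [h]
  simp only [map_add, coeff_C_mul, coeff_pow_mul_negThreeHalvesSeries]
  ring

/-- The coefficients of the square of a cubic, up to degree three. -/
def squareCoeff (c : Fin 4 → ℝ) : Fin 4 → ℝ :=
  ![c 0 ^ 2, 2 * (c 0 * c 1), 2 * (c 0 * c 2) + c 1 ^ 2, 2 * (c 0 * c 3 + c 1 * c 2)]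

theorem reducedSeries_sq_expansion (r : ℕ) :
    ∃ H ∈ weightedAlgebra, reducedSeries r ^ 2 =
      singularCubic (squareCoeff (singularCoeff (4 ^ r))) + (1 - 4 * X) ^ 4 * H := by
  obtain ⟨H, hH, e⟩ := reducedSeries_expansion r
  set c := singularCoeff (4 ^ r)
  have hC := C_mem_weightedAlgebra
  have he := one_sub_four_X_mem
  refine ⟨C (2 * (c 1 * c 3) + c 2 ^ 2) + C (2 * (c 2 * c 3)) * (1 - 4 * X) +
    C (c 3 ^ 2) * (1 - 4 * X) ^ 2 + 2 * singularCubic c * H + (1 - 4 * X) ^ 4 * H ^ 2,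
    add_mem (add_mem (add_mem (add_mem (hC _) (mul_mem (hC _) he))
      (mul_mem (hC _) (pow_mem he 2)))
      (mul_mem (mul_mem (ofNat_mem_weightedAlgebra 2) (singularCubic_mem c)) hH))
      (mul_mem (pow_mem he 4) (pow_mem hH 2)), ?_⟩
  rw [e]
  simp only [singularCubic, squareCoeff, Matrix.cons_val, map_add, map_mul, map_pow, map_ofNat]
  ring

/-- The four terms of the cubic are evaluated exactly. The rest is `ε ^ (j + 4 - 3/2) H`, of order
`centralBinom n / (n + 1) ^ (j + 3)`, and `j ≤ 1` keeps this exponent within the range of the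
weight. The factor `2 * (2 * n + 1)` is `centralBinom (n + 1) / catalan n`. -/
theorem exists_abs_coeff_remainder_le {j : ℕ} (hj : j ≤ 1) {f H : PowerSeries ℝ} {c : Fin 4 → ℝ}
    (hH : H ∈ weightedAlgebra) (hf : f = singularCubic c + (1 - 4 * X) ^ 4 * H) :
    ∃ K : ℝ, 0 ≤ K ∧ ∀ n : ℕ,
      |coeff (n + 1) ((1 - 4 * X) ^ j * negThreeHalvesSeries * f) / catalan n -
        2 * (2 * n + 1) * (c 0 * coeffRatio j (n + 1) + c 1 * coeffRatio (j + 1) (n + 1) +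
          c 2 * coeffRatio (j + 2) (n + 1) + c 3 * coeffRatio (j + 3) (n + 1))| ≤
      K * (2 * (2 * n + 1) / ((n : ℝ) + 2) ^ (j + 3)) := by
  obtain ⟨K, hK, h⟩ := exists_abs_coeffRatio_le (j + 4)
  have hb : ∀ n, |coeff n ((1 - 4 * X) ^ (j + 4) * negThreeHalvesSeries)| ≤
      K * (Nat.centralBinom n / ((n : ℝ) + 1) ^ (j + 3)) := by
    intro n
    rw [coeff_pow_mul_negThreeHalvesSeries, abs_mul, Nat.abs_cast]
    calc _ ≤ K * ((n + 1) / ((n : ℝ) + 1) ^ (j + 4)) * Nat.centralBinom n := by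
          gcongr
          exact h n
      _ = _ := by
          rw [pow_succ ((n : ℝ) + 1) (j + 3)]
          field_simp
  obtain ⟨K', hK', h'⟩ := exists_abs_coeff_mul_le (by omega) hK hb hH
  refine ⟨K', hK', fun n => ?_⟩
  have hc := catalan_pos n
  have e : (1 - 4 * X) ^ j * negThreeHalvesSeries * f =
      (1 - 4 * X) ^ j * negThreeHalvesSeries * singularCubic c +
        (1 - 4 * X) ^ (j + 4) * negThreeHalvesSeries * H := by
    rw [hf]; ring
  have h2 := h' (n + 1)
  rw [e, map_add, coeff_singularCubic_mul]
  rw [centralBinom_succ_eq_catalan] at h2 ⊢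
  rw [add_div, ← mul_assoc, mul_div_cancel_right₀ _ hc.ne', mul_comm (2 * (2 * (n : ℝ) + 1)),
    add_sub_cancel_left, abs_div, abs_of_pos hc, div_le_iff₀ hc]
  refine h2.trans_eq ?_
  push_cast
  rw [add_assoc (n : ℝ) 1 1, one_add_one_eq_two]
  ring

/-! ### Asymptotic expansions -/

theorem isBigO_one_div_pow {f : ℕ → ℝ} {k : ℕ} (K : ℝ) (N : ℕ)
    (h : ∀ n : ℕ, N ≤ n → 0 < (n : ℝ) → |f n| ≤ K * (1 / (n : ℝ) ^ k)) :
    f =O[Filter.atTop] fun n : ℕ => 1 / (n : ℝ) ^ k := by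
  refine Asymptotics.IsBigO.of_bound K ?_
  filter_upwards [Filter.eventually_ge_atTop (N + 1)] with n hn
  have hn0 : 0 < (n : ℝ) := by exact_mod_cast (by omega : 0 < n)
  rw [Real.norm_eq_abs, Real.norm_eq_abs, abs_of_pos (by positivity : 0 < 1 / (n : ℝ) ^ k)]
  exact h n (by omega) hn0

theorem one_div_pow_isBigO {j k : ℕ} (h : k ≤ j) :
    (fun n : ℕ => 1 / (n : ℝ) ^ j) =O[Filter.atTop] fun n : ℕ => 1 / (n : ℝ) ^ k := by
  refine isBigO_one_div_pow 1 1 fun n hn hn0 => ?_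
  have hn1 : (1 : ℝ) ≤ n := by exact_mod_cast hn
  rw [abs_of_pos (by positivity), one_mul]
  exact one_div_le_one_div_of_le (by positivity) (pow_le_pow_right₀ hn1 h)

theorem coeffRatio_one (n : ℕ) : coeffRatio 1 n = 1 := by
  have h := two_mul_sub_odd_ne_zero n 0
  simp only [coeffRatio]
  field_simp
  push_cast
  ring

theorem coeffRatio_two (n : ℕ) : coeffRatio 2 n = -(1 / (2 * n - 1)) := by
  rw [coeffRatio, coeffRatio_one]
  norm_num

theorem coeffRatio_three (n : ℕ) :
    coeffRatio 3 n = 3 / ((2 * n - 1) * (2 * n - 3)) := by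
  rw [coeffRatio, coeffRatio_two, ← neg_mul_neg, neg_neg, neg_neg, div_mul_div_comm]
  norm_num

theorem coeffRatio_four (n : ℕ) :
    coeffRatio 4 n = -15 / ((2 * n - 1) * (2 * n - 3) * (2 * n - 5)) := by
  rw [coeffRatio, coeffRatio_three, mul_neg, div_mul_div_comm, neg_div]
  norm_num

theorem two_mul_sub_one_ne_zero (n : ℕ) : (2 * (n : ℝ) - 1) ≠ 0 := by
  have := two_mul_sub_odd_ne_zero n 1
  norm_num at this
  exact this

theorem two_mul_sub_three_ne_zero (n : ℕ) : (2 * (n : ℝ) - 3) ≠ 0 := by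
  have := two_mul_sub_odd_ne_zero n 2
  norm_num at this
  exact this

theorem remainder_isBigO {f : ℕ → ℝ} {k : ℕ} {K : ℝ} (hK : 0 ≤ K)
    (h : ∀ n : ℕ, |f n| ≤ K * (2 * (2 * n + 1) / ((n : ℝ) + 2) ^ (k + 1))) :
    f =O[Filter.atTop] fun n : ℕ => 1 / (n : ℝ) ^ k := by
  refine isBigO_one_div_pow (K * 4) 0 fun n _ hn => (h n).trans ?_
  rw [mul_assoc]
  gcongr
  rw [mul_one_div, div_le_div_iff₀ (by positivity) (by positivity), pow_succ]
  have : (n : ℝ) ^ k ≤ (n + 2) ^ k := by gcongr; linarith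
  calc 2 * (2 * (n : ℝ) + 1) * n ^ k ≤ (4 * (n + 2)) * (n + 2) ^ k :=
        mul_le_mul (by linarith) this (by positivity) (by positivity)
    _ = _ := by ring

theorem expectation_numBranches_isBigO (r : ℕ) :
    (fun n : ℕ => expectation n (fun t => (numBranches r t : ℝ)) -
      2 * (singularCoeff (4 ^ r) 0 * (2 * n + 1) - singularCoeff (4 ^ r) 1 +
        singularCoeff (4 ^ r) 2 * (3 / (2 * n - 1)) -
        singularCoeff (4 ^ r) 3 * (15 / ((2 * n - 1) * (2 * n - 3)))))
      =O[Filter.atTop] fun n : ℕ => 1 / (n : ℝ) ^ 3 := by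
  obtain ⟨H, hH, e⟩ := reducedSeries_expansion r
  obtain ⟨K, hK, h⟩ := exists_abs_coeff_remainder_le (j := 1) le_rfl hH e
  refine remainder_isBigO hK fun n => ?_
  have h0 := h n
  have hb := X_mul_branchSeries r
  rw [pow_one, ← hb, branchSeries, ← expectation_eq, coeffRatio_one, coeffRatio_two,
    coeffRatio_three, coeffRatio_four] at h0
  convert! h0 using 3
  have h1 : (2 * (n : ℝ) + 1) ≠ 0 := by positivity
  have h2 := two_mul_sub_one_ne_zero n
  have h3 := two_mul_sub_three_ne_zero n
  have e1 : (2 * ((n + 1 : ℕ) : ℝ) - 1) = 2 * n + 1 := by push_cast; ring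
  have e2 : (2 * ((n + 1 : ℕ) : ℝ) - 3) = 2 * n - 1 := by push_cast; ring
  have e3 : (2 * ((n + 1 : ℕ) : ℝ) - 5) = 2 * n - 3 := by push_cast; ring
  rw [e1, e2, e3]
  field_simp
  ring

theorem expectation_pairs_isBigO (r : ℕ) :
    (fun n : ℕ => expectation n (fun t => (numBranches r t : ℝ) * (numBranches r t - 1)) -
      4 * (squareCoeff (singularCoeff (4 ^ r)) 0 * ((2 * n + 1) * (2 * n + 3)) +
        squareCoeff (singularCoeff (4 ^ r)) 1 * (2 * n + 1) -
        squareCoeff (singularCoeff (4 ^ r)) 2 +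
        squareCoeff (singularCoeff (4 ^ r)) 3 * (3 / (2 * n - 1))))
      =O[Filter.atTop] fun n : ℕ => 1 / (n : ℝ) ^ 2 := by
  obtain ⟨H, hH, e⟩ := reducedSeries_sq_expansion r
  obtain ⟨K, hK, h⟩ := exists_abs_coeff_remainder_le (j := 0) (Nat.zero_le 1) hH e
  -- The doubled constant accounts for the factor 2 in `X_mul_branchPairSeries`.
  refine remainder_isBigO (K := 2 * K) (by positivity) fun n => ?_
  have h0 := h n
  have hb := X_mul_branchPairSeries r
  rw [pow_zero, one_mul, zero_add, zero_add, zero_add, coeffRatio_one, coeffRatio_two,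
    coeffRatio_three, coeffRatio] at h0
  rw [expectation_eq, ← branchPairSeries, hb, two_mul (negThreeHalvesSeries * _), map_add, ← two_mul,
    mul_assoc 2 K]
  refine le_trans (le_of_eq ?_) (mul_le_mul_of_nonneg_left h0 zero_le_two)
  rw [← abs_two (α := ℝ), ← abs_mul, abs_two]
  congr 1
  have h1 : (2 * (n : ℝ) + 1) ≠ 0 := by positivity
  have h2 := two_mul_sub_one_ne_zero n
  have e1 : (2 * ((n + 1 : ℕ) : ℝ) - 1) = 2 * n + 1 := by push_cast; ring
  have e2 : (2 * ((n + 1 : ℕ) : ℝ) - 3) = 2 * n - 1 := by push_cast; ring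
  have e3 : (2 * ((n + 1 : ℕ) : ℝ) + 1) = 2 * n + 3 := by push_cast; ring
  have hc := (catalan_pos n).ne'
  rw [e1, e2, e3]
  generalize coeff (n + 1) (negThreeHalvesSeries * reducedSeries r ^ 2) = z
  field_simp
  ring

theorem variance_eq (n : ℕ) (f : BinaryTree Unit → ℝ) :
    variance n f = expectation n (fun t => f t * (f t - 1)) + expectation n f -
      expectation n f ^ 2 := by
  have hc : ((treesOfNumNodesEq n).card : ℝ) ≠ 0 := by
    rw [treesOfNumNodesEq_card_eq_catalan]
    exact (catalan_pos n).ne'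
  rw [variance]
  set m := expectation n f with hm
  have hm' : ∑ t ∈ treesOfNumNodesEq n, f t = m * (treesOfNumNodesEq n).card := by
    rw [hm, expectation, div_mul_cancel₀ _ hc]
  have e : ∀ t, (f t - m) ^ 2 = f t * (f t - 1) + (1 - 2 * m) * f t + m ^ 2 := fun t => by ring
  simp only [expectation, e, sum_add_distrib, ← mul_sum, hm', sum_const, nsmul_eq_mul]
  field_simp
  ring

theorem inv_expansion_isBigO :
    (fun n : ℕ => 1 / (2 * (n : ℝ) - 1) - (1 / (2 * n) + 1 / (4 * (n : ℝ) ^ 2)))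
      =O[Filter.atTop] fun n : ℕ => 1 / (n : ℝ) ^ 3 := by
  refine isBigO_one_div_pow 1 1 fun n hn hn0 => ?_
  have hn1 : (1 : ℝ) ≤ n := by exact_mod_cast hn
  have h1 : 0 < 2 * (n : ℝ) - 1 := by linarith
  have e : 1 / (2 * (n : ℝ) - 1) - (1 / (2 * n) + 1 / (4 * (n : ℝ) ^ 2)) =
      1 / (4 * n ^ 2 * (2 * n - 1)) := by
    field_simp
    ring
  rw [e, abs_of_pos (by positivity), one_mul]
  refine one_div_le_one_div_of_le (by positivity) ?_
  nlinarith [pow_pos hn0 2]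

theorem inv_mul_expansion_isBigO :
    (fun n : ℕ => 1 / ((2 * (n : ℝ) - 1) * (2 * n - 3)) - 1 / (4 * (n : ℝ) ^ 2))
      =O[Filter.atTop] fun n : ℕ => 1 / (n : ℝ) ^ 3 := by
  refine isBigO_one_div_pow 2 3 fun n hn hn0 => ?_
  have hn1 : (3 : ℝ) ≤ n := by exact_mod_cast hn
  have h1 : (n : ℝ) ≤ 2 * (n : ℝ) - 1 := by linarith
  have h3 : (n : ℝ) ≤ 2 * (n : ℝ) - 3 := by linarith
  have h1' : 0 < 2 * (n : ℝ) - 1 := by linarith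
  have h3' : 0 < 2 * (n : ℝ) - 3 := by linarith
  have e : 1 / ((2 * (n : ℝ) - 1) * (2 * n - 3)) - 1 / (4 * (n : ℝ) ^ 2) =
      (8 * n - 3) / (4 * n ^ 2 * ((2 * n - 1) * (2 * n - 3))) := by
    field_simp
    ring
  have h8 : 0 ≤ 8 * (n : ℝ) - 3 := by linarith
  rw [e, abs_of_nonneg (by positivity)]
  calc _ ≤ (8 * (n : ℝ)) / (4 * n ^ 2 * (n * n)) := by
        gcongr
        linarith
    _ = _ := by
        field_simp
        ring

/-- Used for the cross term in the square of the mean: a main part of order `n` times an error of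
order `n ^ (-3)` is of order `n ^ (-2)`. This is why the variance needs the mean up to `O(n ^
(-3))`. -/
theorem laurent_isBigO (a b c d : ℝ) :
    (fun n : ℕ => a * (n : ℝ) + b + c * (1 / n) + d * (1 / (n : ℝ) ^ 2))
      =O[Filter.atTop] fun n : ℕ => (n : ℝ) := by
  have h : ∀ k : ℕ, (fun n : ℕ => 1 / (n : ℝ) ^ k) =O[Filter.atTop] fun n : ℕ => (n : ℝ) := by
    intro k
    refine Asymptotics.IsBigO.of_bound 1 ?_
    filter_upwards [Filter.eventually_ge_atTop 1] with n hn
    have hn1 : (1 : ℝ) ≤ n := by exact_mod_cast hn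
    rw [Real.norm_eq_abs, Real.norm_eq_abs, abs_of_nonneg (by positivity), one_mul, Nat.abs_cast]
    exact (div_le_one_of_le₀ (one_le_pow₀ hn1) (by positivity)).trans hn1
  have h0 := (h 0).const_mul_left b
  have h1 := (h 1).const_mul_left c
  simp only [pow_zero, pow_one, div_one, mul_one] at h0 h1
  exact ((((Asymptotics.isBigO_refl _ _).const_mul_left a).add h0).add h1).add
    ((h 2).const_mul_left d)

theorem expectation_numBranches_expansion (r : ℕ) :
    (fun n : ℕ => expectation n (fun t => (numBranches r t : ℝ)) -
        ((n : ℝ) / 4 ^ r + 1 / 6 * (1 + 5 / 4 ^ r)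
          + 1 / (20 * (n : ℝ)) * (4 ^ r - 1 / 4 ^ r)
          + 1 / (12 * (n : ℝ) ^ 2) *
              (5 * 16 ^ r / 21 - 7 * 4 ^ r / 10 + 97 / (210 * 4 ^ r))))
      =O[Filter.atTop] fun n : ℕ => 1 / (n : ℝ) ^ 3 := by
  have h := expectation_numBranches_isBigO r
  have h1 := inv_expansion_isBigO.const_mul_left (6 * singularCoeff (4 ^ r) 2)
  have h2 := inv_mul_expansion_isBigO.const_mul_left (30 * singularCoeff (4 ^ r) 3)
  refine ((h.add h1).sub h2).congr' ?_ Filter.EventuallyEq.rfl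
  filter_upwards [Filter.eventually_gt_atTop 0] with n hn
  have hn0 : (n : ℝ) ≠ 0 := by exact_mod_cast hn.ne'
  have hq : (4 : ℝ) ^ r ≠ 0 := by positivity
  have h16 : (16 : ℝ) ^ r = (4 ^ r) ^ 2 := by rw [← pow_mul, mul_comm, pow_mul]; norm_num
  rw [h16]
  simp only [singularCoeff, Matrix.cons_val]
  generalize (4 : ℝ) ^ r = q at hq
  generalize expectation n (fun t => (numBranches r t : ℝ)) = m
  have e2 := two_mul_sub_one_ne_zero n
  have e3 := two_mul_sub_three_ne_zero n
  field_simp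
  ring

theorem variance_numBranches_expansion (r : ℕ) :
    (fun n : ℕ => variance n (fun t => (numBranches r t : ℝ)) -
        ((4 ^ r - 1) / (3 * 16 ^ r) * (n : ℝ)
          - (2 * 16 ^ r - 25 * 4 ^ r + 23) / (90 * 16 ^ r)
          - (13 * 64 ^ r - 14 * 16 ^ r + 7 * 4 ^ r - 6) / (420 * 16 ^ r * (n : ℝ))))
      =O[Filter.atTop] fun n : ℕ => 1 / (n : ℝ) ^ 2 := by
  have h16 : (16 : ℝ) ^ r = (4 ^ r) ^ 2 := by rw [← pow_mul, mul_comm, pow_mul]; norm_num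
  have h64 : (64 : ℝ) ^ r = (4 ^ r) ^ 3 := by rw [← pow_mul, mul_comm, pow_mul]; norm_num
  have hq : (4 : ℝ) ^ r ≠ 0 := by positivity
  have hE := expectation_numBranches_expansion r
  have hP := expectation_pairs_isBigO r
  simp only [variance_eq, h16, h64] at hE ⊢
  generalize (4 : ℝ) ^ r = q at hq hE hP ⊢
  set m : ℕ → ℝ := fun n => expectation n fun t => (numBranches r t : ℝ) with hm
  set w := squareCoeff (singularCoeff q) with hw
  set b := 1 / 6 * (1 + 5 / q) with hb
  set c := 1 / 20 * (q - 1 / q) with hc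
  set d := 1 / 12 * (5 * q ^ 2 / 21 - 7 * q / 10 + 97 / (210 * q)) with hd
  set a : ℕ → ℝ := fun n => 1 / q * (n : ℝ) + b + c * (1 / n) + d * (1 / (n : ℝ) ^ 2) with ha
  have hδ : (fun n => m n - a n) =O[Filter.atTop] fun n : ℕ => 1 / (n : ℝ) ^ 3 := by
    refine hE.congr_left fun n => ?_
    rw [ha, hm, hc, hd]
    ring
  have hδ2 := hδ.trans (one_div_pow_isBigO (by norm_num : 2 ≤ 3))
  have hδδ : (fun n => (m n - a n) * (m n - a n))
      =O[Filter.atTop] fun n : ℕ => 1 / (n : ℝ) ^ 2 := by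
    refine ((hδ.mul hδ).congr_right fun n => ?_).trans (one_div_pow_isBigO (by norm_num : 2 ≤ 6))
    rw [div_mul_div_comm, one_mul, ← pow_add]
  have haδ : (fun n => a n * (m n - a n)) =O[Filter.atTop] fun n : ℕ => 1 / (n : ℝ) ^ 2 := by
    refine ((laurent_isBigO (1 / q) b c d).mul hδ).congr' Filter.EventuallyEq.rfl ?_
    filter_upwards [Filter.eventually_gt_atTop 0] with n hn
    have hn0 : (n : ℝ) ≠ 0 := by exact_mod_cast hn.ne'
    field_simp
  have hI := (inv_expansion_isBigO.trans
    (one_div_pow_isBigO (by norm_num : 2 ≤ 3))).const_mul_left (12 * w 3)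
  -- The terms of order `n ^ (-2)` and below that are discarded: `d` comes from the mean, `c ^ 2 + 2
  -- * b * d`, `2 * c * d` and `d ^ 2` from its square, and `3 * w 3` from expanding `12 * w 3 / (2
  -- * n - 1)`.
  have h2 := (one_div_pow_isBigO (le_refl 2)).const_mul_left (d - c ^ 2 - 2 * b * d + 3 * w 3)
  have h3 := (one_div_pow_isBigO (by norm_num : 2 ≤ 3)).const_mul_left (2 * c * d)
  have h4 := (one_div_pow_isBigO (by norm_num : 2 ≤ 4)).const_mul_left (d ^ 2)
  refine (((((((hP.add hI).add hδ2).sub hδδ).sub (haδ.const_mul_left 2)).add h2).sub h3).sub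
    h4).congr' ?_ Filter.EventuallyEq.rfl
  filter_upwards [Filter.eventually_gt_atTop 0] with n hn
  have hn0 : (n : ℝ) ≠ 0 := by exact_mod_cast hn.ne'
  -- The terms of order at least `n ^ (-1)`; those in `n ^ 2` cancel, leaving a variance of order at
  -- most `n`.
  have key : 4 * (w 0 * ((2 * (n : ℝ) + 1) * (2 * n + 3)) + w 1 * (2 * n + 1) - w 2) +
      6 * w 3 * (1 / n) +
      (1 / q * n + b + c * (1 / n)) - ((1 / q * n + b) ^ 2 + 2 * (1 / q) * c +
        (2 * (1 / q) * d + 2 * b * c) * (1 / n)) =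
      (q - 1) / (3 * q ^ 2) * (n : ℝ) - (2 * q ^ 2 - 25 * q + 23) / (90 * q ^ 2) -
        (13 * q ^ 3 - 14 * q ^ 2 + 7 * q - 6) / (420 * q ^ 2 * (n : ℝ)) := by
    simp only [hw, hb, hc, hd, squareCoeff, singularCoeff, Matrix.cons_val]
    field_simp
    ring
  have hn1 : (n : ℝ) * (1 / n) = 1 := by field_simp
  have split : 3 / (2 * (n : ℝ) - 1) = 3 * (1 / (2 * n - 1)) := by ring
  rw [← key, split]
  simp only [ha, hm]
  have p2 : 1 / (n : ℝ) ^ 2 = (1 / n) ^ 2 := by ring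
  have p3 : 1 / (n : ℝ) ^ 3 = (1 / n) ^ 3 := by ring
  have p4 : 1 / (n : ℝ) ^ 4 = (1 / n) ^ 4 := by ring
  have p5 : 1 / (2 * (n : ℝ)) = 1 / 2 * (1 / n) := by ring
  have p6 : 1 / (4 * (n : ℝ) ^ 2) = 1 / 4 * (1 / n) ^ 2 := by ring
  rw [p2, p3, p4, p5, p6]
  generalize (1 / (n : ℝ)) = x at hn1 ⊢
  generalize 1 / (2 * (n : ℝ) - 1) = y
  -- With `x` standing for `1 / n`, only the mixed products in the square of the mean need `n * x =
  -- 1`.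
  linear_combination (2 * (1 / q) * c + 2 * (1 / q) * d * x) * hn1

end RBranches

theorem mainTheorem3 (r : ℕ) :
    ((fun n : ℕ =>
        RBranches.expectation n (fun t => (RBranches.numBranches r t : ℝ)) -
          ((n : ℝ) / 4 ^ r + 1 / 6 * (1 + 5 / 4 ^ r)
            + 1 / (20 * (n : ℝ)) * (4 ^ r - 1 / 4 ^ r)
            + 1 / (12 * (n : ℝ) ^ 2) *
                (5 * 16 ^ r / 21 - 7 * 4 ^ r / 10 + 97 / (210 * 4 ^ r))))
      =O[Filter.atTop] fun n : ℕ => 1 / (n : ℝ) ^ 3) ∧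
    ((fun n : ℕ =>
        RBranches.variance n (fun t => (RBranches.numBranches r t : ℝ)) -
          ((4 ^ r - 1) / (3 * 16 ^ r) * (n : ℝ)
            - (2 * 16 ^ r - 25 * 4 ^ r + 23) / (90 * 16 ^ r)
            - (13 * 64 ^ r - 14 * 16 ^ r + 7 * 4 ^ r - 6) / (420 * 16 ^ r * (n : ℝ))))
      =O[Filter.atTop] fun n : ℕ => 1 / (n : ℝ) ^ 2) :=
  ⟨RBranches.expectation_numBranches_expansion r, RBranches.variance_numBranches_expansion r⟩
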